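/- Let $G$ be a group with decidable word problem (that is, $G$ is generated as a monoid by some finite family for which there is an algorithm deciding whether two given words in the generators are equal in $G$), and suppose that $G$ has a subgroup isomorphic to $\mathbb Z^2$. Let $G'\subseteq G$ be any finite set generating $G$ as a monoid, and consider the Cayley graph of $(G,G')$: its vertices (memory cells) are the elements of $G$, and for each $s\in G'$ an edge marked $s$ goes from $x$ to $xs$; the initial cell is the identity. An $h$-head automaton with $G$-memory is a deterministic two-way automaton with a finite state set $Q$, a finite input alphabet $\Sigma$, a finite memory alphabet $\Delta$, an initial state and a set of accepting states. A memory content is an arbitrary map $\mu\colon G\to\Delta$, which the automaton can only read. Depending on the current state, the $h$ symbols under its heads on the input word extended by a left and a right end marker, and the symbol $\mu(x)$ in the current cell $x$, the transition function gives a new state, a motion $-1$, $0$ or $+1$ for each head, and either a mark $s\in G'$ (move from $x$ to $xs$) or the empty command (stay at $x$). All heads start on the left end marker and never leave the extended word (a command to do so leaves the head in place). The automaton accepts $w\in\Sigma^*$ iff for some memory content $\mu$ its computation on $w$ reaches an accepting state, and it recognizes the language of all words that it accepts. Then for every finite alphabet $\Sigma$, a language $L\subseteq\Sigma^*$ is recognized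 by an automaton with $G$-memory, with some number of heads, if and only if $L$ is recursively enumerable; that is, $\mathbf R(G)=\mathrm{RE}$. -/

import Mathlib

namespace GuessAutomata

/-- A memory model: a directed graph whose edges carry marks from a finite set, with an initial
cell. For every cell `u` the marking is a bijection between the edges leaving `u` and the marks,
so the marked graph is given by the map `next`: the edges leaving `u` are the pairs
`(u, next u a)`, and such an edge is marked `a`. -/
structure MemoryModel where
  Cell : Type*
  Mark : Type*
  finite_mark : Finite Mark
  init : Cell
  next : Cell → Mark → Cell
  next_injective : ∀ u, Function.Injective (next u)

/-- The memory of type `(G, S)` for a finite set `S` of elements of a group `G`: the cells are the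
elements of `G`, the initial cell is `1`, and for each `s ∈ S` an edge marked `s` goes from `x`
to `x * s`. -/
def cayleyMemory (G : Type*) [Group G] (S : Finset G) : MemoryModel where
  Cell := G
  Mark := {s : G // s ∈ S}
  finite_mark := inferInstance
  init := 1
  next x s := x * s.1
  next_injective x _ _ h := Subtype.ext (mul_left_cancel h)

/-- The symbols of the input tape: the input letters and the two end markers. -/
inductive TapeSymbol (A : Type*) where
  | leftEnd : TapeSymbol A
  | letter (a : A) : TapeSymbol A
  | rightEnd : TapeSymbol A

/-- The motion commands `-1`, `0`, `+1` for a head. -/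
inductive Motion where
  | left : Motion
  | stay : Motion
  | right : Motion

/-- The symbol at position `i` of the word `w` extended by the end markers: position `0` carries
the left marker, positions `1, …, |w|` the letters of `w`, position `|w| + 1` the right marker. -/
def tapeAt {A : Type*} (w : List A) : ℕ → TapeSymbol A
  | 0 => .leftEnd
  | i + 1 => match w[i]? with
    | some a => .letter a
    | none => .rightEnd

/-- The effect of a motion command on a head position, on an input word of length `n`. A head does
not leave the segment `0, …, n + 1`: a command to do so leaves it where it is. -/
def moveHead (n : ℕ) : Motion → ℕ → ℕ
  | .left, p => p - 1
  | .stay, p => p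
  | .right, p => min (p + 1) (n + 1)

/-- A deterministic two-way `h`-head automaton with an auxiliary read-only memory of model `M`,
input alphabet `A`, state set `Q` and memory alphabet `D`. The command `none` means that the
memory cell is not changed. -/
structure Automaton (M : MemoryModel) (A : Type*) (h : ℕ) (Q D : Type*) where
  trans : Q → (Fin h → TapeSymbol A) → D → Q × (Fin h → Motion) × Option M.Mark
  start : Q
  accept : Set Q

/-- A configuration: the state, the positions of the heads, the current memory cell. -/
structure Config (M : MemoryModel) (h : ℕ) (Q : Type*) where
  state : Q
  heads : Fin h → ℕ
  cell : M.Cell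

namespace Automaton

variable {M : MemoryModel} {A : Type*} {h : ℕ} {Q D : Type*}

/-- The initial configuration. -/
def initConfig (B : Automaton M A h Q D) : Config M h Q where
  state := B.start
  heads := fun _ => 0
  cell := M.init

/-- One step of the automaton on the input word `w` with memory content `μ`. -/
def step (B : Automaton M A h Q D) (w : List A) (μ : M.Cell → D) (c : Config M h Q) :
    Config M h Q :=
  let r := B.trans c.state (fun i => tapeAt w (c.heads i)) (μ c.cell)
  { state := r.1
    heads := fun i => moveHead w.length (r.2.1 i) (c.heads i)
    cell := match r.2.2 with
      | some a => M.next c.cell a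
      | none => c.cell }

/-- The automaton accepts `w` iff for some memory content it reaches an accepting state. -/
def Accepts (B : Automaton M A h Q D) (w : List A) : Prop :=
  ∃ μ : M.Cell → D, ∃ t : ℕ, ((B.step w μ)^[t] B.initConfig).state ∈ B.accept

/-- The automaton recognizes `L` iff it accepts exactly the words of `L`. -/
def Recognizes (B : Automaton M A h Q D) (L : Language A) : Prop :=
  ∀ w : List A, B.Accepts w ↔ w ∈ L

end Automaton

/-- The class of languages over the alphabet `A` recognized by automata, with any number of heads,
finitely many states and a finite memory alphabet, with an auxiliary memory of model `M`. -/
def recognizedClass (M : MemoryModel) (A : Type*) : Set (Language A) :=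
  {L | ∃ (h : ℕ) (Q D : Type), Finite Q ∧ Finite D ∧
    ∃ B : Automaton M A h Q D, B.Recognizes L}

/-- The class of recursively enumerable languages over the alphabet `A`. (For a finite alphabet
it does not depend on the chosen coding of the letters.) -/
def classRE (A : Type*) [Primcodable A] : Set (Language A) :=
  {L | REPred fun w : List A => w ∈ L}

/-- The word problem of `G` is decidable: for some finite family `g` generating `G` as a monoid
there is an algorithm deciding whether two given words in the generators have the same value
in `G`. -/
def DecidableWordProblem (G : Type*) [Group G] : Prop :=
  ∃ (n : ℕ) (g : Fin n → G), Submonoid.closure (Set.range g) = ⊤ ∧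
    ComputablePred fun p : List (Fin n) × List (Fin n) =>
      (p.1.map g).prod = (p.2.map g).prod

end GuessAutomata

/-!
A recognized language is recursively enumerable (`rePred_accepts`). An accepting computation reads
only finitely many memory cells, so one may guess the finite sequence of symbols read there instead
of the whole memory content. Given this sequence, the run is simulated with the current cell
written as a word in the generators; the guess comes from a memory content iff equal cells were
assigned equal symbols, which the word problem decides.

Conversely, the subgroup `ℤ²` is used as a grid on which the guessed memory content is the
space-time diagram of a halting computation, and the automaton, with one head, verifies this
diagram.

* By Mathlib's translations of partial recursive functions into Turing machines, a recursively
  enumerable language is described by the halting of a Turing machine whose initial tape is spelled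
  by the input word, one fixed block for each letter (`exists_rowSystem`,
  `exists_rowSystem_emittedRow`). For this the word is coded by the number whose binary digits are
  the concatenated blocks.
* The tape is folded at the position of the machine's head. The computation then becomes that of a
  `RowSystem`: a one-sided row of cells in which the next symbol of a cell depends on the cell, its
  two neighbours, the cell `0` and a finite control state (`tmSystem_halts_iff`).
* A walker on `ℤ × ℤ` compares row `0` of the guessed diagram with the input and each row with the
  one above it, carrying only the control state and two symbols (`checker`). If a computation halts
  after `T` steps, only the triangle of the cells `(k, t)` with `k + t ≤ T` matters: row `t + 1` is
  determined one cell less far than row `t`, so no assumption on the symbols outside is needed.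
  The end of row `0` is guessed, too, and the marks of the first and the last cell of the rows are
  verified together with the symbols. Soundness is the invariant `Checked`; together with the run on
  the correct diagram it gives `checker_accepts_iff`.
* An automaton with memory `G` simulates a walker (`Walker.mem_recognizedClass`): every move
  of the walker is replaced by a path in the Cayley graph, spelled by generators, and the cells
  outside the image of `ℤ²` are only passed through. Distinct points of `ℤ²` are distinct cells, so
  any labelling of the grid extends to a memory content.
-/

namespace GuessAutomata

/-! ### Recursively enumerable predicates -/

section RecursivelyEnumerable

variable {α β : Type*} [Primcodable α] [Primcodable β]

/-- A recursively enumerable predicate is semidecided by a primitive recursive test with a time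
bound. -/
theorem exists_test_of_rePred {p : α → Prop} (hp : REPred p) :
    ∃ f : ℕ → α → Bool, Primrec₂ f ∧ (∀ a m n, m ≤ n → f m a → f n a) ∧
      ∀ a, p a ↔ ∃ n, f n a := by
  obtain ⟨c, hc⟩ := Nat.Partrec.Code.exists_code.1 hp
  refine ⟨fun n a => (Nat.Partrec.Code.evaln n c (Encodable.encode a)).isSome, ?_, ?_, ?_⟩
  · exact Primrec.option_isSome.comp (Nat.Partrec.Code.primrec_evaln.comp
      ((Primrec.fst.pair (Primrec.const c)).pair (Primrec.encode.comp Primrec.snd)))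
  · intro a m n hmn h
    obtain ⟨x, hx⟩ := Option.isSome_iff_exists.1 h
    exact Option.isSome_iff_exists.2 ⟨x, Nat.Partrec.Code.evaln_mono hmn hx⟩
  · intro a
    have h : p a ↔ ∃ x, x ∈ c.eval (Encodable.encode a) := by
      rw [hc]
      simp
    rw [h]
    simp only [Option.isSome_iff_exists]
    rw [exists_comm]
    exact exists_congr fun x => Nat.Partrec.Code.evaln_complete

theorem rePred_exists_nat {f : α → ℕ → Bool} (hf : Computable₂ f) :
    REPred fun a => ∃ n, f a n := by
  refine (Partrec.dom_re (Partrec.rfind hf.partrec₂)).of_eq fun a => ?_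
  rw [Nat.rfind_dom']
  constructor
  · rintro ⟨n, hn, -⟩
    exact ⟨n, (Part.mem_some_iff.1 hn).symm⟩
  · rintro ⟨n, hn⟩
    exact ⟨n, Part.mem_some_iff.2 hn.symm, fun _ => trivial⟩

theorem rePred_comp {p : β → Prop} (hp : REPred p) {g : α → β} (hg : Computable g) :
    REPred fun a => p (g a) :=
  Partrec.comp hp hg

theorem rePred_and {p q : α → Prop} (hp : REPred p) (hq : REPred q) :
    REPred fun a => p a ∧ q a := by
  obtain ⟨f, hf, hfm, hfp⟩ := exists_test_of_rePred hp
  obtain ⟨g, hg, hgm, hgq⟩ := exists_test_of_rePred hq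
  refine (rePred_exists_nat (f := fun a n => f n a && g n a)
    (Primrec.and.comp (hf.comp Primrec.snd Primrec.fst)
      (hg.comp Primrec.snd Primrec.fst)).to_comp).of_eq fun a => ?_
  simp only [hfp, hgq, Bool.and_eq_true]
  constructor
  · rintro ⟨n, h1, h2⟩
    exact ⟨⟨n, h1⟩, n, h2⟩
  · rintro ⟨⟨m, h1⟩, n, h2⟩
    exact ⟨max m n, hfm _ _ _ (le_max_left _ _) h1, hgm _ _ _ (le_max_right _ _) h2⟩

theorem rePred_exists {q : α × β → Prop} (hq : REPred q) : REPred fun a => ∃ b, q (a, b) := by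
  obtain ⟨f, hf, -, hfq⟩ := exists_test_of_rePred hq
  refine (rePred_exists_nat (f := fun a n =>
    ((Encodable.decode (α := β) n.unpair.1).map fun b => f n.unpair.2 (a, b)).getD false)
    (Primrec.to_comp ?_)).of_eq fun a => ?_
  · refine Primrec.option_getD.comp (Primrec.option_map (Primrec.decode.comp
      (Primrec.fst.comp (Primrec.unpair.comp Primrec.snd))) ?_) (Primrec.const false)
    exact hf.comp (Primrec.snd.comp (Primrec.unpair.comp (Primrec.snd.comp Primrec.fst)))
      ((Primrec.fst.comp Primrec.fst).pair Primrec.snd)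
  · simp only [hfq]
    constructor
    · rintro ⟨n, h⟩
      cases hb : Encodable.decode (α := β) n.unpair.1 with
      | none => simp [hb] at h
      | some b => exact ⟨b, n.unpair.2, by simpa [hb] using h⟩
    · rintro ⟨b, n, h⟩
      exact ⟨Nat.pair (Encodable.encode b) n, by simpa using h⟩

theorem rePred_forall_mem_list {p : α → Prop} (hp : REPred p) :
    REPred fun l : List α => ∀ a ∈ l, p a := by
  classical
  obtain ⟨f, hf, hfm, hfp⟩ := exists_test_of_rePred hp
  have h : PrimrecRel fun (l : List α) (n : ℕ) => ∀ a ∈ l, f n a = true :=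
    PrimrecRel.forall_mem_list (R := fun a n => f n a = true)
      (Primrec.eq.comp (hf.comp Primrec.snd Primrec.fst) (Primrec.const true))
  refine (rePred_exists_nat (f := fun (l : List α) n => decide (∀ a ∈ l, f n a = true))
    h.decide.to_comp).of_eq fun l => ?_
  simp only [hfp, decide_eq_true_eq]
  constructor
  · rintro ⟨n, h⟩ a ha
    exact ⟨n, h a ha⟩
  · intro h
    induction l with
    | nil => exact ⟨0, by simp⟩
    | cons a l ih =>
      obtain ⟨m, hm⟩ := ih fun b hb => h b (List.mem_cons_of_mem _ hb)
      obtain ⟨n, hn⟩ := h a List.mem_cons_self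
      refine ⟨max m n, fun b hb => ?_⟩
      rcases List.mem_cons.1 hb with rfl | hb
      · exact hfm _ _ _ (le_max_right _ _) hn
      · exact hfm _ _ _ (le_max_left _ _) (hm b hb)

end RecursivelyEnumerable

/-! ### Recognized languages are recursively enumerable -/

/-- Tape symbols as optional optional letters. -/
def tapeSymbolEquiv (A : Type*) : TapeSymbol A ≃ Option (Option A) where
  toFun
    | .leftEnd => none
    | .rightEnd => some none
    | .letter a => some (some a)
  invFun
    | none => .leftEnd
    | some none => .rightEnd
    | some (some a) => .letter a
  left_inv := by rintro (_ | _ | _) <;> rfl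
  right_inv := by rintro (_ | _ | _) <;> rfl

/-- Motions as optional Booleans. -/
def motionEquiv : Motion ≃ Option Bool where
  toFun
    | .stay => none
    | .left => some true
    | .right => some false
  invFun
    | none => .stay
    | some true => .left
    | some false => .right
  left_inv := by rintro (_ | _ | _) <;> rfl
  right_inv := by rintro (_ | _ | _) <;> rfl

instance {A : Type*} [Finite A] : Finite (TapeSymbol A) := Finite.of_equiv _ (tapeSymbolEquiv A).symm

instance : Finite Motion := Finite.of_equiv _ motionEquiv.symm

instance {A : Type*} [Primcodable A] : Primcodable (TapeSymbol A) :=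
  Primcodable.ofEquiv _ (tapeSymbolEquiv A)

instance : Primcodable Motion := Primcodable.ofEquiv _ motionEquiv

theorem primrec_tapeAt {A : Type*} [Primcodable A] : Primrec₂ (tapeAt (A := A)) := by
  have hl : Primrec (TapeSymbol.letter (A := A)) :=
    (Primrec.of_equiv_symm (e := tapeSymbolEquiv A)).comp
      (Primrec.option_some.comp Primrec.option_some)
  refine (Primrec.nat_casesOn Primrec.snd (Primrec.const TapeSymbol.leftEnd)
    (Primrec.option_casesOn (Primrec.list_getElem?.comp (Primrec.fst.comp Primrec.fst) Primrec.snd)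
      (Primrec.const TapeSymbol.rightEnd) (hl.comp Primrec.snd).to₂).to₂).of_eq ?_
  rintro ⟨w, _ | i⟩
  · rfl
  · simp only [tapeAt]
    cases w[i]? <;> rfl

theorem primrec_moveHead : Primrec fun x : ℕ × Motion × ℕ => moveHead x.1 x.2.1 x.2.2 := by
  classical
  have hm : Primrec fun x : ℕ × Motion × ℕ => x.2.1 := Primrec.fst.comp Primrec.snd
  have hp : Primrec fun x : ℕ × Motion × ℕ => x.2.2 := Primrec.snd.comp Primrec.snd
  refine (Primrec.ite (Primrec.eq.comp hm (Primrec.const Motion.left)) (Primrec.pred.comp hp)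
    (Primrec.ite (Primrec.eq.comp hm (Primrec.const Motion.stay)) hp
      (Primrec.nat_min.comp (Primrec.succ.comp hp) (Primrec.succ.comp Primrec.fst)))).of_eq ?_
  rintro ⟨n, _ | _ | _, p⟩ <;> simp [moveHead]

section Traces

variable {M : MemoryModel} {A Q D : Type*} {h n : ℕ}

/-- The data of a computation from which the memory is absent: the state, the positions of the
heads, a word in the generators for the current cell, and the list of the pairs of a cell (given by
a word) and the symbol that was read there. -/
abbrev Trace (Q D : Type*) (h n : ℕ) : Type _ :=
  (Q × (Fin h → ℕ) × List (Fin n)) × List (List (Fin n) × D)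

/-- The step of the automaton `B` on the input `w` in which it reads the memory symbol `d`; the
words `wd` spell the moves. -/
def traceStep (B : Automaton M A h Q D) (wd : Option M.Mark → List (Fin n)) (w : List A)
    (x : Trace Q D h n) (d : D) : Trace Q D h n :=
  let r := B.trans x.1.1 (fun i => tapeAt w (x.1.2.1 i)) d
  ((r.1, fun i => moveHead w.length (r.2.1 i) (x.1.2.1 i), x.1.2.2 ++ wd r.2.2),
    (x.1.2.2, d) :: x.2)

/-- The computation of `B` on the input `w` in which the symbols in the list are read. -/
def traceRun (B : Automaton M A h Q D) (wd : Option M.Mark → List (Fin n)) (w : List A)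
    (l : List D) : Trace Q D h n :=
  l.foldl (traceStep B wd w) ((B.start, fun _ => 0, []), [])

theorem primrec_traceRun [Primcodable A] [Finite A] [Primcodable Q] [Finite Q] [Primcodable D]
    [Finite D] (B : Automaton M A h Q D) (wd : Option M.Mark → List (Fin n)) :
    Primrec₂ (traceRun B wd) := by
  suffices hstep : Primrec fun y : (List A × List D) × Trace Q D h n × D =>
      traceStep B wd y.1.1 y.2.1 y.2.2 from
    Primrec.list_foldl Primrec.snd (Primrec.const _) hstep.to₂
  let T : Q × (Fin h → TapeSymbol A) × D → Q × (Fin h → Motion) × List (Fin n) := fun x =>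
    ((B.trans x.1 x.2.1 x.2.2).1, (B.trans x.1 x.2.1 x.2.2).2.1, wd (B.trans x.1 x.2.1 x.2.2).2.2)
  have hT : Primrec T := Primrec.dom_finite T
  have hw : Primrec fun y : (List A × List D) × Trace Q D h n × D => y.1.1 :=
    Primrec.fst.comp Primrec.fst
  have hx : Primrec fun y : (List A × List D) × Trace Q D h n × D => y.2.1 :=
    Primrec.fst.comp Primrec.snd
  have hd : Primrec fun y : (List A × List D) × Trace Q D h n × D => y.2.2 :=
    Primrec.snd.comp Primrec.snd
  have hq := Primrec.fst.comp (Primrec.fst.comp hx)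
  have hp := Primrec.fst.comp (Primrec.snd.comp (Primrec.fst.comp hx))
  have hu := Primrec.snd.comp (Primrec.snd.comp (Primrec.fst.comp hx))
  have hσ : Primrec fun y : (List A × List D) × Trace Q D h n × D =>
      fun i => tapeAt y.1.1 (y.2.1.1.2.1 i) :=
    Primrec.fin_curry.2 (primrec_tapeAt.comp (hw.comp Primrec.fst)
      (Primrec.fin_app.comp (hp.comp Primrec.fst) Primrec.snd))
  have hr := hT.comp (hq.pair (hσ.pair hd))
  have hm : Primrec fun y : (List A × List D) × Trace Q D h n × D => fun i =>
      moveHead y.1.1.length ((T (y.2.1.1.1, (fun i => tapeAt y.1.1 (y.2.1.1.2.1 i)), y.2.2)).2.1 i)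
        (y.2.1.1.2.1 i) :=
    Primrec.fin_curry.2 (primrec_moveHead.comp
      ((Primrec.list_length.comp (hw.comp Primrec.fst)).pair
        ((Primrec.fin_app.comp ((Primrec.fst.comp (Primrec.snd.comp hr)).comp Primrec.fst)
          Primrec.snd).pair (Primrec.fin_app.comp (hp.comp Primrec.fst) Primrec.snd))))
  exact ((Primrec.fst.comp hr).pair (hm.pair (Primrec.list_append.comp hu
    (Primrec.snd.comp (Primrec.snd.comp hr))))).pair
    (Primrec.list_cons.comp (hu.pair hd) (Primrec.snd.comp hx))

theorem subset_foldl_traceStep (B : Automaton M A h Q D) (wd : Option M.Mark → List (Fin n))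
    (w : List A) (l : List D) (x : Trace Q D h n) : x.2 ⊆ (l.foldl (traceStep B wd w) x).2 := by
  induction l generalizing x with
  | nil => exact fun _ h => h
  | cons d l ih => exact fun y hy => ih _ (List.mem_cons_of_mem _ hy)

end Traces

section Group

variable {G : Type*} [Group G] {S : Finset G} {A Q D : Type*} {h n : ℕ}

/-- The value of a word in the generators `g`. -/
def wordValue (g : Fin n → G) (l : List (Fin n)) : G := (l.map g).prod

/-- The trace `x` describes the configuration `c`. -/
def Describes (g : Fin n → G) (x : Trace Q D h n) (c : Config (cayleyMemory G S) h Q) : Prop :=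
  x.1.1 = c.state ∧ x.1.2.1 = c.heads ∧ wordValue g x.1.2.2 = c.cell

theorem Describes.step {g : Fin n → G} {x : Trace Q D h n} {c : Config (cayleyMemory G S) h Q}
    (hx : Describes g x c) (B : Automaton (cayleyMemory G S) A h Q D)
    {wd : Option {s : G // s ∈ S} → List (Fin n)}
    (hwd : ∀ m : Option {s : G // s ∈ S}, wordValue g (wd m) = m.elim 1 Subtype.val)
    (w : List A) {μ : G → D} {d : D} (hd : d = μ (wordValue g x.1.2.2)) :
    Describes g (traceStep B wd w x d) (B.step w μ c) := by
  obtain ⟨q, p, u⟩ := c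
  obtain ⟨rfl, rfl, rfl⟩ := hx
  refine ⟨by rw [hd]; rfl, by rw [hd]; rfl, ?_⟩
  have happ : ∀ m : Option {s : G // s ∈ S}, wordValue g (x.1.2.2 ++ wd m) =
      wordValue g x.1.2.2 * m.elim 1 Subtype.val := by
    intro m
    rw [← hwd, wordValue, List.map_append, List.prod_append, wordValue, wordValue]
  rw [hd]
  refine (happ _).trans ?_
  simp only [Automaton.step]
  cases (B.trans x.1.1 (fun i => tapeAt w (x.1.2.1 i)) (μ (wordValue g x.1.2.2))).2.2 with
  | none => exact mul_one (wordValue g x.1.2.2)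
  | some a => rfl

/-- The pairs of entries of a list. -/
def allPairs {α : Type*} (l : List α) : List (α × α) := l.flatMap fun x => l.map fun y => (x, y)

/-- Acceptance in terms of the symbols read: a list of symbols is read with some memory content iff
no cell is assigned two different symbols. -/
theorem accepts_iff_exists_trace [Nonempty D] {g : Fin n → G}
    (B : Automaton (cayleyMemory G S) A h Q D) {wd : Option {s : G // s ∈ S} → List (Fin n)}
    (hwd : ∀ m : Option {s : G // s ∈ S}, wordValue g (wd m) = m.elim 1 Subtype.val)
    (w : List A) :
    B.Accepts w ↔ ∃ l : List D, (traceRun B wd w l).1.1 ∈ B.accept ∧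
      ∀ x ∈ allPairs (traceRun B wd w l).2,
        wordValue g x.1.1 = wordValue g x.2.1 → x.1.2 = x.2.2 := by
  have hinit : Describes g (((B.start, fun _ => 0, []), []) : Trace Q D h n) B.initConfig :=
    ⟨rfl, rfl, rfl⟩
  constructor
  · rintro ⟨μ, t, ht⟩
    change G → D at μ
    have key : ∀ t, ∃ l : List D, Describes g (traceRun B wd w l) ((B.step w μ)^[t] B.initConfig) ∧
        ∀ y ∈ (traceRun B wd w l).2, y.2 = μ (wordValue g y.1) := by
      intro t
      induction t with
      | zero => exact ⟨[], hinit, by simp [traceRun]⟩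
      | succ t ih =>
        obtain ⟨l, hl, hμ⟩ := ih
        refine ⟨l ++ [μ (wordValue g (traceRun B wd w l).1.2.2)], ?_, ?_⟩
        · rw [Function.iterate_succ_apply']
          unfold traceRun
          rw [List.foldl_append]
          exact hl.step B hwd w rfl
        · intro y hy
          unfold traceRun at hy
          rw [List.foldl_append] at hy
          rcases List.mem_cons.1 hy with rfl | hy
          exacts [rfl, hμ y hy]
    obtain ⟨l, hl, hμ⟩ := key t
    refine ⟨l, by rw [hl.1]; exact ht, fun x hx => ?_⟩
    simp only [allPairs, List.mem_flatMap, List.mem_map] at hx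
    obtain ⟨y, hy, z, hz, rfl⟩ := hx
    intro he
    rw [hμ y hy, hμ z hz, he]
  · rintro ⟨l, hacc, hl⟩
    classical
    -- A memory content that agrees with all the guesses.
    let μ : G → D := fun x => if hx : ∃ y ∈ (traceRun B wd w l).2, wordValue g y.1 = x then
      hx.choose.2 else Classical.arbitrary D
    have hμ : ∀ y ∈ (traceRun B wd w l).2, y.2 = μ (wordValue g y.1) := by
      intro y hy
      have hx : ∃ z ∈ (traceRun B wd w l).2, wordValue g z.1 = wordValue g y.1 := ⟨y, hy, rfl⟩
      rw [show μ (wordValue g y.1) = hx.choose.2 from dif_pos hx]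
      refine hl (y, hx.choose) ?_ hx.choose_spec.2.symm
      simp only [allPairs, List.mem_flatMap, List.mem_map]
      exact ⟨y, hy, _, hx.choose_spec.1, rfl⟩
    have key : ∀ (l : List D) (x : Trace Q D h n) (c : Config (cayleyMemory G S) h Q),
        Describes g x c →
        (∀ y ∈ (l.foldl (traceStep B wd w) x).2, y.2 = μ (wordValue g y.1)) →
        Describes g (l.foldl (traceStep B wd w) x) ((B.step w μ)^[l.length] c) := by
      intro l
      induction l with
      | nil => exact fun x c hx _ => hx
      | cons d l ih =>
        intro x c hx hy
        refine ih _ _ (hx.step B hwd w ?_) hy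
        exact hy (x.1.2.2, d) (subset_foldl_traceStep B wd w l _ List.mem_cons_self)
    exact ⟨μ, l.length, by rw [← (key l _ _ hinit hμ).1]; exact hacc⟩

/-- A language recognized by an automaton is recursively enumerable: guess the symbols that the
automaton reads, simulate it, and check with the word problem that equal cells got equal
symbols. -/
theorem rePred_accepts [Primcodable A] [Finite A] [Primcodable Q] [Finite Q] [Primcodable D]
    [Finite D] (hword : DecidableWordProblem G) (B : Automaton (cayleyMemory G S) A h Q D) :
    REPred fun w => B.Accepts w := by
  classical
  -- With an empty memory alphabet there is no memory content, so that no word is accepted.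
  rcases isEmpty_or_nonempty D with hD | hD
  · have : ComputablePred fun _ : List A => False :=
      ComputablePred.computable_iff.2 ⟨fun _ => false, Computable.const _, by simp⟩
    refine this.to_re.of_eq fun w => ⟨False.elim, ?_⟩
    rintro ⟨μ, -⟩
    exact hD.elim (μ (1 : G))
  obtain ⟨n, g, hg, hdec⟩ := hword
  have hex (x : G) : ∃ l : List (Fin n), wordValue g l = x := by
    have hx : x ∈ Submonoid.closure (Set.range g) := hg ▸ Submonoid.mem_top x
    obtain ⟨l, hl, rfl⟩ := Submonoid.exists_list_of_mem_closure hx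
    choose f hf using fun y : {y // y ∈ l} => hl y.1 y.2
    exact ⟨l.attach.map f, by simp [wordValue, List.map_map, Function.comp_def, hf]⟩
  choose wd hwd using fun m : Option {s : G // s ∈ S} => hex (m.elim 1 Subtype.val)
  refine REPred.of_eq ?_ fun w => (accepts_iff_exists_trace B hwd w).symm
  have hrun : Primrec fun y : List A × List D => traceRun B wd y.1 y.2 := primrec_traceRun B wd
  have hpairs : Primrec fun l : List (List (Fin n) × D) => allPairs l :=
    Primrec.list_flatMap Primrec.id
      (Primrec.list_map Primrec.fst ((Primrec.snd.comp Primrec.fst).pair Primrec.snd).to₂).to₂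
  have hacc : REPred fun y : List A × List D => (traceRun B wd y.1 y.2).1.1 ∈ B.accept := by
    refine (ComputablePred.computable_iff.2 ⟨fun y : List A × List D =>
      decide ((traceRun B wd y.1 y.2).1.1 ∈ B.accept), ?_, by simp⟩).to_re
    exact ((Primrec.dom_finite fun q : Q => decide (q ∈ B.accept)).comp
      (Primrec.fst.comp (Primrec.fst.comp hrun))).to_comp
  have hcons : REPred fun x : (List (Fin n) × D) × (List (Fin n) × D) =>
      wordValue g x.1.1 = wordValue g x.2.1 → x.1.2 = x.2.2 := by
    obtain ⟨f, hf, hfe⟩ := ComputablePred.computable_iff.1 hdec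
    refine (ComputablePred.computable_iff.2 ⟨fun x : (List (Fin n) × D) × (List (Fin n) × D) =>
      !f (x.1.1, x.2.1) || decide (x.1.2 = x.2.2), ?_, ?_⟩).to_re
    · refine Primrec.or.to_comp.comp (Primrec.not.to_comp.comp (hf.comp
        ((Computable.fst.comp Computable.fst).pair (Computable.fst.comp Computable.snd))))
        (Primrec.to_comp ?_)
      exact PrimrecPred.decide (Primrec.eq.comp (Primrec.snd.comp Primrec.fst)
        (Primrec.snd.comp Primrec.snd))
    · funext x
      have := congrFun hfe (x.1.1, x.2.1)
      simp only at this
      simp only [wordValue, this]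
      cases f (x.1.1, x.2.1) <;> simp
  exact rePred_exists (rePred_and hacc (rePred_comp (rePred_forall_mem_list hcons)
    (hpairs.comp (Primrec.snd.comp hrun)).to_comp))

theorem mem_classRE_of_mem_recognizedClass [Finite A] [Primcodable A]
    (hword : DecidableWordProblem G) {L : Language A}
    (hL : L ∈ recognizedClass (cayleyMemory G S) A) : L ∈ classRE A := by
  obtain ⟨h, Q, D, _, _, B, hB⟩ := hL
  let _ : Primcodable Q := Primcodable.ofEquiv _ (Finite.equivFin Q)
  let _ : Primcodable D := Primcodable.ofEquiv _ (Finite.equivFin D)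
  exact (rePred_accepts hword B).of_eq hB

end Group

/-! ### Walkers on the integer grid -/

/-- A one-head automaton with memory `ℤ × ℤ` that, in a single step, reads the labels of the
current cell, of the cell to its right and of the cell above it, and then moves by a vector of
its choice. -/
structure Walker (A W D : Type*) where
  trans : W → TapeSymbol A → D → D → D → W × Motion × (ℤ × ℤ)
  start : W
  accept : Set W

/-- A configuration of a walker: the state, the position of the head, the current cell. -/
structure WalkerConfig (W : Type*) where
  state : W
  head : ℕ
  pos : ℤ × ℤ

namespace Walker

variable {A W D : Type*}

/-- The command given by the walker in a configuration. -/
def command (B : Walker A W D) (w : List A) (ν : ℤ × ℤ → D) (c : WalkerConfig W) :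
    W × Motion × (ℤ × ℤ) :=
  B.trans c.state (tapeAt w c.head) (ν c.pos) (ν (c.pos + (1, 0))) (ν (c.pos + (0, 1)))

/-- One step of the walker on the input word `w` with memory content `ν`. -/
def step (B : Walker A W D) (w : List A) (ν : ℤ × ℤ → D) (c : WalkerConfig W) :
    WalkerConfig W where
  state := (B.command w ν c).1
  head := moveHead w.length (B.command w ν c).2.1 c.head
  pos := c.pos + (B.command w ν c).2.2

/-- The initial configuration. -/
def initConfig (B : Walker A W D) : WalkerConfig W := ⟨B.start, 0, 0⟩

/-- The walker accepts `w` iff for some memory content it reaches an accepting state. -/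
def Accepts (B : Walker A W D) (w : List A) : Prop :=
  ∃ ν : ℤ × ℤ → D, ∃ t : ℕ, ((B.step w ν)^[t] B.initConfig).state ∈ B.accept

end Walker

/-- The states of the automaton simulating a walker with states `W` and memory alphabet `D`: a
state of the walker, the labels already read during the current step of the walker (none, one or
two), and the list of the marks (coded by numbers) of the edges still to be followed. -/
abbrev SimState (W D : Type) (m K : ℕ) : Type :=
  W × Option (D × Option D) × {l : List (Fin m) // l.length ≤ K}

section Simulation

variable {G : Type*} [Group G] {S : Finset G} {A : Type*} {W D : Type} {m K : ℕ}

/-- The automaton simulating a walker. The mark number `i` is `mk i`, and `word v` is a list of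
marks leading from a cell `φ u` to the cell `φ (u + v)`. The automaton passes from the current cell
of the walker to the cell to the right by `(1, 0)`, then to the cell above by `(-1, 1)`, and the
final `(0, -1)` undoes these moves before the move of the walker. -/
def simAutomaton (B : Walker A W D) (mk : Fin m → {s : G // s ∈ S})
    (word : ℤ × ℤ → {l : List (Fin m) // l.length ≤ K}) :
    Automaton (cayleyMemory G S) A 1 (SimState W D m K) D where
  trans q σ d :=
    match q with
    | (q, b, ⟨i :: l, hl⟩) =>
        ((q, b, ⟨l, by simp only [List.length_cons] at hl; omega⟩), fun _ => .stay, some (mk i))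
    | (q, none, ⟨[], _⟩) => ((q, some (d, none), word (1, 0)), fun _ => .stay, none)
    | (q, some (x, none), ⟨[], _⟩) =>
        ((q, some (x, some d), word (-1, 1)), fun _ => .stay, none)
    | (q, some (x, some y), ⟨[], _⟩) =>
        (((B.trans q (σ 0) x y d).1, none, word ((B.trans q (σ 0) x y d).2.2 + (0, -1))),
          fun _ => (B.trans q (σ 0) x y d).2.1, none)
  start := (B.start, none, ⟨[], by simp⟩)
  accept := {q | q.1 ∈ B.accept}

/-- The element of the group by which following the marks in the list multiplies a cell. -/
def wordProd (mk : Fin m → {s : G // s ∈ S}) (l : List (Fin m)) : G :=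
  (l.map fun i => (mk i).1).prod

/-- The configuration of the simulating automaton with state `q`, head position `p` and cell `g`
occurs during the simulation of a step from the configuration `c` of the walker. -/
def Simulates (φ : ℤ × ℤ → G) (mk : Fin m → {s : G // s ∈ S}) (ν : ℤ × ℤ → D)
    (c : WalkerConfig W) (q : SimState W D m K) (p : ℕ) (g : G) : Prop :=
  q.1 = c.state ∧ p = c.head ∧
    match q.2.1 with
    | none => g * wordProd mk q.2.2.1 = φ c.pos
    | some (x, none) => g * wordProd mk q.2.2.1 = φ (c.pos + (1, 0)) ∧ x = ν c.pos
    | some (x, some y) => g * wordProd mk q.2.2.1 = φ (c.pos + (0, 1)) ∧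
        x = ν c.pos ∧ y = ν (c.pos + (1, 0))

/-- A bound for the number of steps before the next label read is the last one of a step of the
walker. -/
def SimState.size (q : SimState W D m K) : ℕ :=
  (match q.2.1 with
    | none => 2
    | some (_, none) => 1
    | some (_, some _) => 0) * (K + 1) + q.2.2.1.length

variable {B : Walker A W D} {mk : Fin m → {s : G // s ∈ S}}
  {word : ℤ × ℤ → {l : List (Fin m) // l.length ≤ K}} {φ : ℤ × ℤ → G}
  {w : List A} {μ : G → D}

/-- A step of the simulating automaton continues the simulation of the current step of the walker
or finishes it. -/
theorem Simulates.step (hφ : ∀ u v, φ (u + v) = φ u * φ v)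
    (hw₁ : wordProd mk (word (1, 0)).1 = φ (1, 0))
    (hw₂ : wordProd mk (word (-1, 1)).1 = φ (-1, 1))
    (hw₃ : ∀ q σ x y d, wordProd mk (word ((B.trans q σ x y d).2.2 + (0, -1))).1 =
      φ ((B.trans q σ x y d).2.2 + (0, -1)))
    {c : WalkerConfig W} {c' : Config (cayleyMemory G S) 1 (SimState W D m K)}
    (h : Simulates φ mk (fun v => μ (φ v)) c c'.state (c'.heads 0) c'.cell)
    {c₁ : Config (cayleyMemory G S) 1 (SimState W D m K)}
    (hc₁ : (simAutomaton B mk word).step w μ c' = c₁) :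
    (Simulates φ mk (fun v => μ (φ v)) c c₁.state (c₁.heads 0) c₁.cell ∧
      c₁.state.size < c'.state.size) ∨
    Simulates φ mk (fun v => μ (φ v)) (B.step w (fun v => μ (φ v)) c)
      c₁.state (c₁.heads 0) c₁.cell := by
  subst hc₁
  obtain ⟨⟨q, b, l, hl⟩, hd, g⟩ := c'
  obtain ⟨cs, ch, cp⟩ := c
  obtain ⟨rfl, h2, h3⟩ := h
  simp only at h2 h3
  change G at g
  cases l with
  | cons i l =>
    left
    have hp : g * wordProd mk (i :: l) = (g * (mk i).1) * wordProd mk l := by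
      simp [wordProd, mul_assoc]
    rw [hp] at h3
    refine ⟨?_, ?_⟩
    · rcases b with _ | ⟨x, _ | y⟩ <;> exact ⟨rfl, h2, h3⟩
    · rcases b with _ | ⟨x, _ | y⟩ <;> simp [SimState.size, simAutomaton, Automaton.step]
  | nil =>
    have hp : g * wordProd mk [] = g := by simp [wordProd]
    rw [hp] at h3
    rcases b with _ | ⟨x, _ | y⟩
    · left
      refine ⟨⟨rfl, h2, ?_, ?_⟩, ?_⟩
      · change g * wordProd mk (word (1, 0)).1 = _
        rw [h3, hw₁, hφ]
      · change μ g = _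
        rw [h3]
      · have := (word (1, 0)).2
        simp only [SimState.size, simAutomaton, Automaton.step, List.length_nil]
        omega
    · left
      refine ⟨⟨rfl, h2, ?_, h3.2, ?_⟩, ?_⟩
      · change g * wordProd mk (word (-1, 1)).1 = _
        rw [h3.1, hw₂, ← hφ, add_assoc]
        rfl
      · change μ g = _
        rw [h3.1]
      · have := (word (-1, 1)).2
        simp only [SimState.size, simAutomaton, Automaton.step, List.length_nil]
        omega
    · right
      obtain ⟨h3, rfl, rfl⟩ := h3
      have hc : B.trans q (tapeAt w (hd 0)) (μ (φ cp)) (μ (φ (cp + (1, 0)))) (μ g) =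
          B.command w (fun v => μ (φ v)) ⟨q, ch, cp⟩ := by
        simp only [Walker.command, h2, h3]
      refine ⟨congrArg (fun r => r.1) hc, ?_, ?_⟩
      · change moveHead _ (B.trans q (tapeAt w (hd 0)) _ _ (μ g)).2.1 (hd 0) = moveHead _ _ _
        rw [hc, h2]
      · change g * wordProd mk (word ((B.trans q (tapeAt w (hd 0)) _ _ (μ g)).2.2 + (0, -1))).1 =
          φ (_ + _)
        rw [hw₃, hc, h3, ← hφ]
        congr 1
        ext <;> simp [add_comm]

/-- The simulating automaton completes every step of the walker that it simulates. -/
theorem Simulates.exists_step (hφ : ∀ u v, φ (u + v) = φ u * φ v)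
    (hw₁ : wordProd mk (word (1, 0)).1 = φ (1, 0))
    (hw₂ : wordProd mk (word (-1, 1)).1 = φ (-1, 1))
    (hw₃ : ∀ q σ x y d, wordProd mk (word ((B.trans q σ x y d).2.2 + (0, -1))).1 =
      φ ((B.trans q σ x y d).2.2 + (0, -1)))
    {c : WalkerConfig W} {c' : Config (cayleyMemory G S) 1 (SimState W D m K)}
    (h : Simulates φ mk (fun v => μ (φ v)) c c'.state (c'.heads 0) c'.cell) :
    ∃ n c₁, ((simAutomaton B mk word).step w μ)^[n] c' = c₁ ∧
      Simulates φ mk (fun v => μ (φ v)) (B.step w (fun v => μ (φ v)) c)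
        c₁.state (c₁.heads 0) c₁.cell := by
  induction hn : c'.state.size using Nat.strong_induction_on generalizing c' with
  | _ n ih =>
    rcases h.step hφ hw₁ hw₂ hw₃ rfl with ⟨h', hlt⟩ | h'
    · obtain ⟨k, c₁, hk, hc₁⟩ := ih _ (hn ▸ hlt) h' rfl
      exact ⟨k + 1, c₁, by rwa [Function.iterate_succ_apply], hc₁⟩
    · exact ⟨1, _, rfl, h'⟩

end Simulation

/-- Every element of a group generated as a monoid by `S` is the value of a list of marks. -/
theorem exists_wordProd {G : Type*} [Group G] {S : Finset G}
    (hS : Submonoid.closure (S : Set G) = ⊤) {m : ℕ} (mk : Fin m ≃ {s : G // s ∈ S}) (x : G) :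
    ∃ l : List (Fin m), wordProd mk l = x := by
  obtain ⟨l, hl, rfl⟩ := Submonoid.exists_list_of_mem_closure (hS ▸ Submonoid.mem_top x)
  refine ⟨l.attach.map fun y => mk.symm ⟨y.1, hl y.1 y.2⟩, ?_⟩
  simp [wordProd, List.map_map, Function.comp_def]

/-- If `ℤ × ℤ` embeds in `G`, the automata with memory `G` recognize the languages recognized by
walkers. -/
theorem Walker.mem_recognizedClass {G : Type*} [Group G] {S : Finset G}
    (hS : Submonoid.closure (S : Set G) = ⊤) {φ : ℤ × ℤ → G} (hφ : ∀ u v, φ (u + v) = φ u * φ v)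
    (hinj : Function.Injective φ) {A : Type*} [Finite A] {W D : Type} [Finite W] [Finite D]
    (B : Walker A W D) {L : Language A} (hL : ∀ w, B.Accepts w ↔ w ∈ L) :
    L ∈ recognizedClass (cayleyMemory G S) A := by
  have mk := (Finite.equivFin {s : G // s ∈ S}).symm
  generalize Nat.card {s : G // s ∈ S} = m at mk
  choose word₀ hword₀ using fun v => exists_wordProd hS mk (φ v)
  -- The finite set of the displacements that occur during a simulation.
  let V : Set (ℤ × ℤ) := insert (1, 0) (insert (-1, 1) (Set.range
    fun r : W × TapeSymbol A × D × D × D =>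
      (B.trans r.1 r.2.1 r.2.2.1 r.2.2.2.1 r.2.2.2.2).2.2 + (0, -1)))
  have hV : V.Finite := ((Set.finite_range _).insert _).insert _
  obtain ⟨K, hK⟩ := (hV.image fun v => (word₀ v).length).bddAbove
  have hK' : ∀ v ∈ V, (word₀ v).length ≤ K := fun v hv => hK ⟨v, hv, rfl⟩
  let word (v : ℤ × ℤ) : {l : List (Fin m) // l.length ≤ K} :=
    ⟨(word₀ v).take K, List.length_take_le _ _⟩
  have hword : ∀ v ∈ V, wordProd mk (word v).1 = φ v := fun v hv => by
    rw [← hword₀]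
    exact congrArg _ (List.take_of_length_le (hK' v hv))
  have hw₁ := hword (1, 0) (by simp [V])
  have hw₂ := hword (-1, 1) (by simp [V])
  have hw₃ (q σ x y d) := hword ((B.trans q σ x y d).2.2 + (0, -1))
    (.inr (.inr ⟨(q, σ, x, y, d), rfl⟩))
  have hφ0 : φ 0 = 1 := by simpa using hφ 0 0
  have hinit (ν : ℤ × ℤ → D) : Simulates φ mk ν B.initConfig
      (simAutomaton B mk word).initConfig.state ((simAutomaton B mk word).initConfig.heads 0)
      (simAutomaton B mk word).initConfig.cell :=
    ⟨rfl, rfl, show (1 : G) * wordProd mk [] = φ 0 by simp [wordProd, hφ0]⟩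
  have : Finite {l : List (Fin m) // l.length ≤ K} := (List.finite_length_le (Fin m) K).to_subtype
  refine ⟨1, SimState W D m K, D, inferInstance, inferInstance, simAutomaton B mk word,
    fun w => (Iff.trans ?_ (hL w))⟩
  constructor
  · rintro ⟨μ, t, ht⟩
    change G → D at μ
    have key : ∀ t, ∃ n, ∀ c₁, ((simAutomaton B mk word).step w μ)^[t]
        (simAutomaton B mk word).initConfig = c₁ →
        Simulates φ mk (fun v => μ (φ v)) ((B.step w (fun v => μ (φ v)))^[n] B.initConfig)
          c₁.state (c₁.heads 0) c₁.cell := by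
      intro t
      induction t with
      | zero => exact ⟨0, by rintro _ rfl; exact hinit _⟩
      | succ t ih =>
        obtain ⟨n, hn⟩ := ih
        rcases (hn _ rfl).step hφ hw₁ hw₂ hw₃ rfl with ⟨h, -⟩ | h
        · exact ⟨n, by rintro _ rfl; rwa [Function.iterate_succ_apply']⟩
        · exact ⟨n + 1, by rintro _ rfl; rwa [Function.iterate_succ_apply',
            Function.iterate_succ_apply']⟩
    obtain ⟨n, hn⟩ := key t
    refine ⟨fun v => μ (φ v), n, ?_⟩
    rw [← (hn _ rfl).1]
    exact ht
  · rintro ⟨ν, t, ht⟩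
    -- The labels outside the grid do not matter.
    let μ : G → D := Function.extend φ ν fun _ => ν 0
    have hμ : (fun v => μ (φ v)) = ν := funext fun v => hinj.extend_apply _ _ _
    have key : ∀ t, ∃ n c₁, ((simAutomaton B mk word).step w μ)^[n]
        (simAutomaton B mk word).initConfig = c₁ ∧
        Simulates φ mk (fun v => μ (φ v)) ((B.step w (fun v => μ (φ v)))^[t] B.initConfig)
          c₁.state (c₁.heads 0) c₁.cell := by
      intro t
      induction t with
      | zero => exact ⟨0, _, rfl, hinit _⟩
      | succ t ih =>
        obtain ⟨n, c₁, rfl, h⟩ := ih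
        obtain ⟨k, c₂, hk, h₂⟩ := h.exists_step hφ hw₁ hw₂ hw₃
        exact ⟨k + n, c₂, by rw [Function.iterate_add_apply, hk],
          by rwa [Function.iterate_succ_apply']⟩
    obtain ⟨n, c₁, hc₁, h⟩ := key t
    refine ⟨μ, n, ?_⟩
    rw [hc₁]
    change c₁.state.1 ∈ B.accept
    rw [h.1, hμ]
    exact ht

/-! ### Row systems and their space-time diagrams -/

/-- A row system: a one-sided infinite row of cells, rewritten synchronously under a finite
control. In state `s`, with symbol `c₀` in the cell `0`, the new state is `next s c₀`, and the new
symbol of a cell is `rule s c₀ p c n`, where `c` is its symbol, `n` that of its right neighbour and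
`p` that of its left neighbour (`none` for the cell `0`). -/
structure RowSystem (S C : Type*) where
  next : S → C → S
  rule : S → C → Option C → C → C → C
  start : S
  halt : Set S

namespace RowSystem

variable {S C : Type*}

/-- One step of a row system, on pairs of a state and a row. -/
def step (R : RowSystem S C) (x : S × (ℕ → C)) : S × (ℕ → C) :=
  (R.next x.1 (x.2 0), fun k =>
    R.rule x.1 (x.2 0) (if k = 0 then none else some (x.2 (k - 1))) (x.2 k) (x.2 (k + 1)))

/-- The state and the row after `t` steps from the row `ρ`. -/
def run (R : RowSystem S C) (ρ : ℕ → C) (t : ℕ) : S × (ℕ → C) := R.step^[t] (R.start, ρ)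

theorem run_succ (R : RowSystem S C) (ρ : ℕ → C) (t : ℕ) :
    R.run ρ (t + 1) = R.step (R.run ρ t) := Function.iterate_succ_apply' ..

/-- The row system reaches a halting state from the row `ρ`. -/
def Halts (R : RowSystem S C) (ρ : ℕ → C) : Prop := ∃ t, (R.run ρ t).1 ∈ R.halt

end RowSystem

section Emission

variable {A C : Type*} (blk : TapeSymbol A → List C) (blank : C)

/-- One step in the production of the row that spells an input word, where each symbol `σ` of the
extended word is spelled by the block `blk σ`. The state is the part of the last block that is
still to be produced; with the symbol under the head this determines the next letter of the row,
the next state and the motion of the head. -/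
def emit (l : List C) (σ : TapeSymbol A) : C × List C × Motion :=
  match l with
  | x :: l => (x, l, .stay)
  | [] => match blk σ with
    | x :: l => (x, l, .right)
    | [] => (blank, [], .right)

/-- The pending part of the block and the position of the head after the first `k` letters of the
row. -/
def emission (w : List A) : ℕ → List C × ℕ
  | 0 => ([], 0)
  | k + 1 =>
    let e := emit blk blank (emission w k).1 (tapeAt w (emission w k).2)
    (e.2.1, moveHead w.length e.2.2 (emission w k).2)

/-- The row that spells the word `w`. -/
def emittedRow (w : List A) (k : ℕ) : C :=
  (emit blk blank (emission blk blank w k).1 (tapeAt w (emission blk blank w k).2)).1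

theorem emit_length_le {K : ℕ} (hblk : ∀ σ, (blk σ).length ≤ K) {l : List C} (hl : l.length ≤ K)
    (σ : TapeSymbol A) : (emit blk blank l σ).2.1.length ≤ K := by
  unfold emit
  split
  · simp only [List.length_cons] at hl
    exact (Nat.le_succ _).trans hl
  · have := hblk σ
    split
    · simp_all only [List.length_cons]
      omega
    · exact Nat.zero_le _

/-- The symbols of the extended word from position `p` on. -/
def tapeFrom (w : List A) (p : ℕ) : List (TapeSymbol A) :=
  (TapeSymbol.leftEnd :: (w.map TapeSymbol.letter ++ [TapeSymbol.rightEnd])).drop p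

theorem tapeFrom_eq_cons (w : List A) {p : ℕ} (hp : p ≤ w.length + 1) :
    tapeFrom w p = tapeAt w p :: tapeFrom w (p + 1) := by
  have hlen : p < (TapeSymbol.leftEnd ::
      (w.map TapeSymbol.letter ++ [TapeSymbol.rightEnd])).length := by simp; omega
  rw [tapeFrom, List.drop_eq_getElem_cons hlen, ← tapeFrom]
  congr 1
  rcases p with _ | p
  · rfl
  · rcases Nat.lt_or_ge p w.length with h | h
    · simp [tapeAt, h]
    · simp [tapeAt, List.getElem_append, Nat.not_lt.2 h]

/-- The emitted row consists of the blocks of the symbols of the extended word, continued with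
blanks. -/
theorem emittedRow_eq (hblk : ∀ σ, blk σ ≠ []) (hend : blk .rightEnd = [blank]) (w : List A)
    (k : ℕ) : emittedRow blk blank w k = ((tapeFrom w 0).flatMap blk).getD k blank := by
  -- After `k` letters, the rest of the row is the pending part of the block, followed by the blocks
  -- from the head on. At the right end marker this rest is blank, although the head does not move.
  have key : ∀ k, (emission blk blank w k).2 ≤ w.length + 1 ∧ ∀ j,
      ((emission blk blank w k).1 ++
        (tapeFrom w (emission blk blank w k).2).flatMap blk).getD j blank =
      ((tapeFrom w 0).flatMap blk).getD (k + j) blank := by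
    intro k
    induction k with
    | zero => exact ⟨Nat.zero_le _, fun j => by simp [emission]⟩
    | succ k ih =>
      obtain ⟨hp, ih⟩ := ih
      simp only [emission]
      generalize emission blk blank w k = e at *
      obtain ⟨l, p⟩ := e
      simp only at hp ih ⊢
      rcases l with _ | ⟨x, l⟩
      · have hne := hblk (tapeAt w p)
        rcases hb : blk (tapeAt w p) with _ | ⟨x, l⟩
        · exact absurd hb hne
        · simp only [emit, hb, moveHead]
          refine ⟨min_le_right _ _, fun j => ?_⟩
          have := ih (j + 1)
          rw [tapeFrom_eq_cons w hp] at this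
          simp only [List.flatMap_cons, hb, List.nil_append, List.cons_append,
            List.getD_cons_succ] at this
          rw [show k + 1 + j = k + (j + 1) by omega, ← this]
          rcases Nat.lt_or_ge p (w.length + 1) with h | h
          · rw [min_eq_left (by omega)]
          · have hpe : p = w.length + 1 := le_antisymm hp h
            subst hpe
            have h1 : tapeFrom w (w.length + 1 + 1) = [] := by simp [tapeFrom]
            have h2 : tapeAt w (w.length + 1) = .rightEnd := by simp [tapeAt]
            rw [h2, hend] at hb
            simp only [List.cons.injEq] at hb
            rw [min_eq_right (by omega), tapeFrom_eq_cons w le_rfl, h1, h2, ← hb.2]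
            simp only [List.flatMap_cons, List.flatMap_nil, hend]
            cases j <;> simp
      · simp only [emit, moveHead]
        refine ⟨hp, fun j => ?_⟩
        have := ih (j + 1)
        rw [show k + 1 + j = k + (j + 1) by omega, ← this]
        simp
  obtain ⟨hp, h⟩ := key k
  have h0 := h 0
  rw [add_zero] at h0
  rw [← h0, emittedRow]
  rw [tapeFrom_eq_cons w hp]
  generalize emission blk blank w k = e at *
  obtain ⟨l, p⟩ := e
  rcases l with _ | ⟨x, l⟩
  · rcases hb : blk (tapeAt w p) with _ | ⟨x, l⟩
    · exact absurd hb (hblk _)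
    · simp [emit, hb]
  · simp [emit]

end Emission

/-! ### Verification of space-time diagrams by a walker -/

/-- A label of the grid: the cell `(k, t)` carries the symbol of the cell `k` in the row `t`, and
tells whether it lies in column `0` and whether it is the last cell of the row `t` of the
diagram. -/
structure Label (C : Type*) where
  symbol : C
  isOrigin : Bool
  isEnd : Bool

instance Label.finite {C : Type*} [Finite C] : Finite (Label C) :=
  Finite.of_injective (fun d : Label C => (d.symbol, d.isOrigin, d.isEnd))
    (by rintro ⟨_, _, _⟩ ⟨_, _, _⟩ h; simp_all)

/-- The states of the walker that verifies a diagram.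
* `init first l`: checks row `0` against the input, from left to right; `first` tells whether the
  current column is `0`, and `l` is the pending part of the current block.
* `sweep s p`: checks row `t + 1` against row `t`, from left to right, where `s` is the state of the
  row system at time `t`; `p` consists of the symbols in column `0` and in the previous column of
  row `t`, and is `none` in column `0`.
* `back s`: returns to column `0`; `s` is the state of the row system at time `t`.
* `fail`: the diagram is wrong. -/
inductive CheckState (S C : Type*) (K : ℕ) where
  | init (first : Bool) (l : {l : List C // l.length ≤ K})
  | sweep (s : S) (p : Option (C × C))
  | back (s : S)
  | fail

instance CheckState.finite {S C : Type*} {K : ℕ} [Finite S] [Finite C] :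
    Finite (CheckState S C K) := by
  have : Finite {l : List C // l.length ≤ K} := (List.finite_length_le C K).to_subtype
  refine Finite.of_surjective
    (fun x : ((Bool × {l : List C // l.length ≤ K}) ⊕ (S × Option (C × C))) ⊕ Option S =>
      match x with
      | .inl (.inl (b, l)) => CheckState.init b l
      | .inl (.inr (s, p)) => .sweep s p
      | .inr (some s) => .back s
      | .inr none => .fail) ?_
  rintro (⟨b, l⟩ | ⟨s, p⟩ | s | _)
  exacts [⟨.inl (.inl (b, l)), rfl⟩, ⟨.inl (.inr (s, p)), rfl⟩, ⟨.inr (some s), rfl⟩,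
    ⟨.inr none, rfl⟩]

section Checker

open scoped Classical

variable {A S C : Type*} {K : ℕ} (R : RowSystem S C) (blk : TapeSymbol A → List C) (blank : C)
  (hblk : ∀ σ, (blk σ).length ≤ K)

/-- The walker that verifies that the memory holds a space-time diagram of the row system,
starting from the row that spells the input and ending in a halting state. The diagram is a
triangle: each row is shorter by one cell than the row below it, because the symbol of a cell
depends on the right neighbour. -/
noncomputable def checker : Walker A (CheckState S C K) (Label C) where
  trans q σ cur right up :=
    match q with
    | .init first l =>
      if cur.symbol = (emit blk blank l.1 σ).1 ∧ cur.isOrigin = first then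
        if cur.isEnd then (.back R.start, .stay, (0, 0))
        else (.init false ⟨(emit blk blank l.1 σ).2.1, emit_length_le blk blank hblk l.2 σ⟩,
          (emit blk blank l.1 σ).2.2, (1, 0))
      else (.fail, .stay, (0, 0))
    | .sweep s p =>
      if cur.isEnd = false ∧ up.symbol = R.rule s (p.elim cur.symbol Prod.fst) (p.map Prod.snd)
          cur.symbol right.symbol ∧ up.isOrigin = cur.isOrigin ∧ up.isEnd = right.isEnd then
        if right.isEnd then (.back (R.next s (p.elim cur.symbol Prod.fst)), .stay, (0, 1))
        else (.sweep s (some (p.elim cur.symbol Prod.fst, cur.symbol)), .stay, (1, 0))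
      else (.fail, .stay, (0, 0))
    | .back s => if cur.isOrigin then (.sweep s none, .stay, (0, 0)) else (.back s, .stay, (-1, 0))
    | .fail => (.fail, .stay, (0, 0))
  start := .init true ⟨[], Nat.zero_le _⟩
  accept := {q | ∃ s ∈ R.halt, q = .back s}

/-- The label of the cell `k` of a row with symbols `ρ` whose last cell is `e`. -/
def rowLabel (ρ : ℕ → C) (e k : ℕ) : Label C := ⟨ρ k, decide (k = 0), decide (k = e)⟩

/-- The cell of the grid in column `k` and row `t`. -/
def gridCell (k t : ℕ) : ℤ × ℤ := (k, t)

theorem gridCell_add_right (k t : ℕ) : gridCell k t + (1, 0) = gridCell (k + 1) t := by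
  simp [gridCell]

theorem gridCell_add_up (k t : ℕ) : gridCell k t + (0, 1) = gridCell k (t + 1) := by
  simp [gridCell]

theorem gridCell_add_left (k t : ℕ) : gridCell (k + 1) t + (-1, 0) = gridCell k t := by
  simp [gridCell]

theorem gridCell_add_zero (k t : ℕ) : gridCell k t + (0, 0) = gridCell k t := by
  simp [gridCell]

/-- The state of the checker in column `k` of row `t` during the comparison with row `t + 1`, where
`x` is the state and the row at time `t`. -/
def sweepState (x : S × (ℕ → C)) (k : ℕ) : CheckState S C K :=
  .sweep x.1 (if k = 0 then none else some (x.2 0, x.2 (k - 1)))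

/-- What the checker has verified when it is in a given configuration. -/
def Checked (w : List A) (ν : ℤ × ℤ → Label C) (c : WalkerConfig (CheckState S C K)) : Prop :=
  match c.state with
  | .init first l => ∃ k : ℕ, c.pos = gridCell k 0 ∧ (l.1, c.head) = emission blk blank w k ∧
      first = decide (k = 0) ∧
      ∀ j < k, ν (gridCell j 0) = ⟨emittedRow blk blank w j, decide (j = 0), false⟩
  | .sweep s p => ∃ t e k : ℕ, c.pos = gridCell k t ∧ k ≤ e ∧
      .sweep s p = sweepState (K := K) (R.run (emittedRow blk blank w) t) k ∧
      (∀ j ≤ e, ν (gridCell j t) = rowLabel (R.run (emittedRow blk blank w) t).2 e j) ∧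
      ∀ j < k, ν (gridCell j (t + 1)) =
        ⟨(R.run (emittedRow blk blank w) (t + 1)).2 j, decide (j = 0), decide (j + 1 = e)⟩
  | .back s => ∃ t e k : ℕ, c.pos = gridCell k t ∧ k ≤ e ∧
      s = (R.run (emittedRow blk blank w) t).1 ∧
      ∀ j ≤ e, ν (gridCell j t) = rowLabel (R.run (emittedRow blk blank w) t).2 e j
  | .fail => True

variable {R blk blank} in
/-- The checker verifies the diagram one cell further, or moves within its verified part. -/
theorem Checked.step {w : List A} {ν : ℤ × ℤ → Label C} {c : WalkerConfig (CheckState S C K)}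
    (h : Checked R blk blank w ν c) :
    Checked R blk blank w ν ((checker R blk blank hblk).step w ν c) := by
  obtain ⟨q, p, x⟩ := c
  cases q with
  | init first l =>
    obtain ⟨k, hx, hl, hfirst, hrow⟩ := h
    simp only at hx hl hfirst
    subst hx
    have hemit : emittedRow blk blank w k = (emit blk blank l.1 (tapeAt w p)).1 := by
      rw [emittedRow, ← hl]
    simp only [Walker.step, Walker.command, checker]
    split_ifs with h1 h2
    · refine ⟨0, k, k, gridCell_add_zero _ _, le_rfl, rfl, fun j hj => ?_⟩
      rcases hj.lt_or_eq with hj | rfl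
      · rw [hrow j hj]
        simp [rowLabel, RowSystem.run, hj.ne]
      · simp only [rowLabel, RowSystem.run, Function.iterate_zero, id]
        rw [hemit, ← h1.1, ← hfirst, ← h1.2]
        simp [← h2]
    · refine ⟨k + 1, gridCell_add_right _ _, ?_, by simp, fun j hj => ?_⟩
      · simp only [emission, ← hl]
      · rcases (Nat.lt_succ_iff.1 hj).lt_or_eq with hj | rfl
        · exact hrow j hj
        · rw [hemit, ← h1.1, ← hfirst, ← h1.2, ← Bool.eq_false_iff.2 h2]
    · trivial
  | sweep s p' =>
    obtain ⟨t, e, k, hx, hk, hs, hrow, hnew⟩ := h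
    simp only at hx
    subst hx
    simp only [sweepState, CheckState.sweep.injEq] at hs
    obtain ⟨rfl, rfl⟩ := hs
    have hcur := hrow k hk
    have hc0 : (if k = 0 then none else some ((R.run (emittedRow blk blank w) t).2 0,
        (R.run (emittedRow blk blank w) t).2 (k - 1))).elim
          (ν (gridCell k t)).symbol Prod.fst = (R.run (emittedRow blk blank w) t).2 0 := by
      split_ifs with hk0
      · subst hk0
        exact congrArg Label.symbol hcur
      · rfl
    have hprev : (if k = 0 then none else some ((R.run (emittedRow blk blank w) t).2 0,
        (R.run (emittedRow blk blank w) t).2 (k - 1))).map Prod.snd =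
          if k = 0 then none else some ((R.run (emittedRow blk blank w) t).2 (k - 1)) := by
      split_ifs <;> rfl
    generalize (if k = 0 then none else some ((R.run (emittedRow blk blank w) t).2 0,
        (R.run (emittedRow blk blank w) t).2 (k - 1))) = pr at hc0 hprev
    simp only [Walker.step, Walker.command, checker, hc0, gridCell_add_right, gridCell_add_up]
    split_ifs with h1 h2
    all_goals try trivial
    all_goals
      obtain ⟨h3, h4, h5, h6⟩ := h1
      -- In the last cell of a row the right neighbour is not verified, but there the checker fails.
      have hke : k < e := by
        refine lt_of_le_of_ne hk fun hke => ?_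
        rw [hcur] at h3
        simp [rowLabel, hke] at h3
      have hright := hrow (k + 1) hke
      have hup : ν (gridCell k (t + 1)) = ⟨(R.run (emittedRow blk blank w) (t + 1)).2 k,
          decide (k = 0), decide (k + 1 = e)⟩ := by
        have h7 : ν (gridCell k (t + 1)) = ⟨(ν (gridCell k (t + 1))).symbol,
          (ν (gridCell k (t + 1))).isOrigin, (ν (gridCell k (t + 1))).isEnd⟩ := rfl
        rw [h7, h4, h5, h6, hright, hcur, RowSystem.run_succ, RowSystem.step]
        simp only [rowLabel]
        rw [hprev]
      have hnew' : ∀ j < k + 1, ν (gridCell j (t + 1)) =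
          ⟨(R.run (emittedRow blk blank w) (t + 1)).2 j, decide (j = 0), decide (j + 1 = e)⟩ := by
        intro j hj
        rcases (Nat.lt_succ_iff.1 hj).lt_or_eq with hj | rfl
        exacts [hnew j hj, hup]
    · rw [hright] at h2
      simp only [rowLabel, decide_eq_true_eq] at h2
      refine ⟨t + 1, k, k, gridCell_add_up _ _, le_rfl, by rw [RowSystem.run_succ]; rfl,
        fun j hj => ?_⟩
      rw [hnew' j (by omega), rowLabel]
      congr 1
      simp only [decide_eq_decide]
      omega
    · refine ⟨t, e, k + 1, gridCell_add_right _ _, hke, ?_, hrow, hnew'⟩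
      simp [sweepState, hcur, rowLabel]
  | back s =>
    obtain ⟨t, e, k, hx, hk, hs, hrow⟩ := h
    simp only at hx
    subst hx
    have hcur := hrow k hk
    simp only [Walker.step, Walker.command, checker, hcur, rowLabel, decide_eq_true_eq]
    split_ifs with h1
    · refine ⟨t, e, k, gridCell_add_zero _ _, hk, ?_, hrow, fun j hj => by omega⟩
      simp [sweepState, h1, hs]
    · obtain ⟨k, rfl⟩ := Nat.exists_eq_succ_of_ne_zero h1
      exact ⟨t, e, k, gridCell_add_left _ _, by omega, hs, hrow⟩
  | fail => trivial

/-- The correct diagram with `T + 1` rows: row `t` has the cells `0, …, T - t`. -/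
def diagram (ρ : ℕ → C) (T : ℕ) (v : ℤ × ℤ) : Label C :=
  rowLabel (R.run ρ v.2.toNat).2 (T - v.2.toNat) v.1.toNat

theorem diagram_gridCell (ρ : ℕ → C) (T k t : ℕ) :
    diagram R ρ T (gridCell k t) = rowLabel (R.run ρ t).2 (T - t) k := by
  simp [diagram, gridCell]

/-- Within a row of the correct diagram the checker finds no error. -/
theorem checker_step_sweep {w : List A} {ρ : ℕ → C} {T t k p : ℕ} (hk : k < T - t) :
    (checker R blk blank hblk).step w (diagram R ρ T) ⟨sweepState (R.run ρ t) k, p, gridCell k t⟩ =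
      if k + 1 = T - t then ⟨.back (R.run ρ (t + 1)).1, p, gridCell k (t + 1)⟩
      else ⟨sweepState (R.run ρ t) (k + 1), p, gridCell (k + 1) t⟩ := by
  have hc0 : (if k = 0 then none else some ((R.run ρ t).2 0, (R.run ρ t).2 (k - 1))).elim
      ((R.run ρ t).2 k) Prod.fst = (R.run ρ t).2 0 := by
    split_ifs with h
    · rw [h]; rfl
    · rfl
  have hprev : (if k = 0 then none else some ((R.run ρ t).2 0, (R.run ρ t).2 (k - 1))).map
      Prod.snd = if k = 0 then none else some ((R.run ρ t).2 (k - 1)) := by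
    split_ifs <;> rfl
  have hend : decide (k = T - (t + 1)) = decide (k + 1 = T - t) := by
    simp only [decide_eq_decide]
    omega
  have hrun : (R.run ρ (t + 1)).2 k = R.rule (R.run ρ t).1 ((R.run ρ t).2 0)
      (if k = 0 then none else some ((R.run ρ t).2 (k - 1))) ((R.run ρ t).2 k)
      ((R.run ρ t).2 (k + 1)) := by
    rw [RowSystem.run_succ]; rfl
  simp only [Walker.step, Walker.command, checker, sweepState, gridCell_add_right,
    gridCell_add_up, diagram_gridCell, rowLabel, hc0, hprev, hend, hrun, decide_eq_true_eq]
  rw [if_pos (by simpa using hk.ne)]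
  by_cases h1 : k + 1 = T - t
  · simp [h1, moveHead, gridCell_add_up, RowSystem.run_succ, RowSystem.step]
  · simp [h1, moveHead, gridCell_add_right]

/-- Some memory content is accepted by the checker iff the row system halts on the row that spells
the input. -/
theorem checker_accepts_iff (w : List A) :
    (checker R blk blank hblk).Accepts w ↔ R.Halts (emittedRow blk blank w) := by
  constructor
  · rintro ⟨ν, n, s, hs, hn⟩
    have key : ∀ n, Checked R blk blank w ν
        (((checker R blk blank hblk).step w ν)^[n] (checker R blk blank hblk).initConfig) := by
      intro n
      induction n with
      | zero => exact ⟨0, rfl, rfl, rfl, fun j hj => absurd hj (Nat.not_lt_zero j)⟩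
      | succ n ih =>
        rw [Function.iterate_succ_apply']
        exact ih.step hblk
    have h := key n
    rw [Checked, hn] at h
    obtain ⟨t, -, -, -, -, rfl, -⟩ := h
    exact ⟨t, hs⟩
  · rintro ⟨T, hT⟩
    let ρ := emittedRow blk blank w
    let ν := diagram R ρ T
    let B := checker R blk blank hblk
    have hν : ∀ k t, ν (gridCell k t) = rowLabel (R.run ρ t).2 (T - t) k := diagram_gridCell R ρ T
    let Reach (c : WalkerConfig (CheckState S C K)) : Prop :=
      ∃ n, (B.step w ν)^[n] B.initConfig = c
    have hstep {c c' : WalkerConfig (CheckState S C K)} (h : Reach c) (hc : B.step w ν c = c') :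
        Reach c' := by
      obtain ⟨n, rfl⟩ := h
      exact ⟨n + 1, by rw [Function.iterate_succ_apply', hc]⟩
    have hinit : ∀ k ≤ T, ∃ hl, Reach ⟨.init (decide (k = 0)) ⟨(emission blk blank w k).1, hl⟩,
        (emission blk blank w k).2, gridCell k 0⟩ := by
      intro k
      induction k with
      | zero => exact fun _ => ⟨Nat.zero_le _, 0, rfl⟩
      | succ k ih =>
        intro hk
        obtain ⟨hl, h⟩ := ih (by omega)
        refine ⟨emit_length_le blk blank hblk hl _, hstep h ?_⟩
        simp [B, checker, Walker.step, Walker.command, hν, rowLabel, RowSystem.run, ρ,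
          emittedRow, show k ≠ T by omega, emission, gridCell_add_right]
    have hback : ∀ t p k, Reach ⟨.back (R.run ρ t).1, p, gridCell k t⟩ →
        Reach ⟨.sweep (R.run ρ t).1 none, p, gridCell 0 t⟩ := by
      intro t p k
      induction k with
      | zero =>
        intro h
        refine hstep h ?_
        simp only [B, checker, Walker.step, Walker.command, hν, rowLabel]
        simp [moveHead]
      | succ k ih =>
        intro h
        refine ih (hstep h ?_)
        simp only [B, checker, Walker.step, Walker.command, hν, rowLabel]
        simp [moveHead, gridCell_add_left]
    have hsweep : ∀ t p, Reach ⟨.sweep (R.run ρ t).1 none, p, gridCell 0 t⟩ →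
        ∀ k < T - t, Reach ⟨sweepState (R.run ρ t) k, p, gridCell k t⟩ := by
      intro t p h k
      induction k with
      | zero => exact fun _ => h
      | succ k ih =>
        intro hk
        refine hstep (ih (by omega)) ((checker_step_sweep R blk blank hblk (by omega)).trans ?_)
        rw [if_neg (by omega)]
    have hrow : ∀ t ≤ T, ∃ k p : ℕ, Reach ⟨.back (R.run ρ t).1, p, gridCell k t⟩ := by
      intro t
      induction t with
      | zero =>
        intro _
        obtain ⟨hl, h⟩ := hinit T le_rfl
        refine ⟨T, (emission blk blank w T).2, hstep h ?_⟩
        simp [B, checker, Walker.step, Walker.command, hν, rowLabel, RowSystem.run, ρ,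
          emittedRow, moveHead]
      | succ t ih =>
        intro ht
        obtain ⟨k, p, h⟩ := ih (by omega)
        have h := hsweep t p (hback t p k h) (T - t - 1) (by omega)
        refine ⟨T - t - 1, p, hstep h ((checker_step_sweep R blk blank hblk (by omega)).trans ?_)⟩
        rw [if_pos (by omega)]
    obtain ⟨k, p, n, hn⟩ := hrow T le_rfl
    refine ⟨ν, n, ?_⟩
    change ((B.step w ν)^[n] B.initConfig).state ∈ _
    rw [hn]
    exact ⟨_, hT, rfl⟩

end Checker

/-! ### Turing machines as row systems -/

section TuringMachine

open Turing

open scoped Classical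

variable {Γ Λ : Type} [Inhabited Γ] [Inhabited Λ] (M : TM0.Machine Γ Λ) (T : Finset Λ)

/-- The Turing machine `M`, with states in `T`, as a row system. The tape is folded at the head:
the cell `k` of the row carries the symbols at distance `k + 1` to the left and at distance `k` to
the right of the head. The state `none` is the halting state. -/
noncomputable def tmSystem (q₀ : T) : RowSystem (Option T) (Γ × Γ) where
  next s c := s.bind fun q => (M q c.2).bind fun r => if h : r.1 ∈ T then some ⟨r.1, h⟩ else none
  rule s c₀ p c n :=
    match s.bind fun q => M q c₀.2 with
    | none => c
    | some (_, .write b) => if p.isNone then (c.1, b) else c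
    | some (_, .move .right) => ((p.map Prod.fst).getD c.2, n.2)
    | some (_, .move .left) => (n.1, (p.map Prod.snd).getD c.1)
  start := some q₀
  halt := {none}

/-- The row that represents a tape. -/
def tapeRow (t : Tape Γ) (k : ℕ) : Γ × Γ := (t.left.nth k, t.right₀.nth k)

/-- The state and the row `x` represent the configuration `c`. -/
def Represents (x : Option T × (ℕ → Γ × Γ)) (c : TM0.Cfg Γ Λ) : Prop :=
  x.1.map Subtype.val = some c.q ∧ x.2 = tapeRow c.Tape

variable {M T}

/-- A step of the Turing machine is a step of the row system. -/
theorem Represents.step (hT : TM0.Supports M T) (q₀ : T) {x : Option T × (ℕ → Γ × Γ)}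
    {c c' : TM0.Cfg Γ Λ} (hx : Represents T x c) (hc : c' ∈ TM0.step M c) :
    Represents T ((tmSystem M T q₀).step x) c' := by
  obtain ⟨s, ρ⟩ := x
  obtain ⟨q, ⟨a, L, R⟩⟩ := c
  obtain ⟨hs, rfl⟩ := hx
  obtain ⟨⟨q, hq⟩, rfl, rfl⟩ := Option.map_eq_some_iff.1 hs
  obtain ⟨⟨q', stmt⟩, hM, rfl⟩ := Option.map_eq_some_iff.1 hc
  have hq' : q' ∈ T := hT.2 hM hq
  simp only at hM
  refine ⟨?_, ?_⟩
  · simp [RowSystem.step, tmSystem, tapeRow, Tape.right₀, hM, hq']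
  · funext k
    rcases stmt with (_ | _) | b <;> rcases k with _ | k <;>
      simp [RowSystem.step, tmSystem, tapeRow, Tape.right₀, hM, Tape.move, Tape.write]

theorem tmSystem_halts_iff (hT : TM0.Supports M T) (l : List Γ) :
    (tmSystem M T ⟨default, hT.1⟩).Halts (tapeRow (Tape.mk₁ l)) ↔ (TM0.eval M l).Dom := by
  have hinit : Represents T (some ⟨default, hT.1⟩, tapeRow (Tape.mk₁ l)) (TM0.init l) := ⟨rfl, rfl⟩
  have hdom : (TM0.eval M l).Dom ↔ ∃ c, StateTransition.Reaches (TM0.step M) (TM0.init l) c ∧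
      TM0.step M c = none := by
    change (StateTransition.eval _ _).Dom ↔ _
    simp only [Part.dom_iff_mem, StateTransition.mem_eval]
  rw [hdom]
  constructor
  · rintro ⟨t, ht⟩
    by_contra! hne
    have key : ∀ t, ∃ c, StateTransition.Reaches (TM0.step M) (TM0.init l) c ∧
        Represents T ((tmSystem M T ⟨default, hT.1⟩).run (tapeRow (Tape.mk₁ l)) t) c := by
      intro t
      induction t with
      | zero => exact ⟨_, .refl, hinit⟩
      | succ t ih =>
        obtain ⟨c, hc, hx⟩ := ih
        obtain ⟨c', hc'⟩ := Option.ne_none_iff_exists'.1 (hne c hc)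
        exact ⟨c', hc.tail hc', by rw [RowSystem.run_succ]; exact hx.step hT _ hc'⟩
    obtain ⟨c, -, hx, -⟩ := key t
    rw [show ((tmSystem M T ⟨default, hT.1⟩).run (tapeRow (Tape.mk₁ l)) t).1 = none from ht] at hx
    cases hx
  · rintro ⟨c, hc, hnone⟩
    have key : ∃ t, Represents T
        ((tmSystem M T ⟨default, hT.1⟩).run (tapeRow (Tape.mk₁ l)) t) c := by
      clear hnone
      induction hc with
      | refl => exact ⟨0, hinit⟩
      | tail _ hc ih =>
        obtain ⟨t, ht⟩ := ih
        exact ⟨t + 1, by rw [RowSystem.run_succ]; exact ht.step hT _ hc⟩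
    obtain ⟨t, hs, hρ⟩ := key
    refine ⟨t + 1, ?_⟩
    obtain ⟨q, hq, hqc⟩ := Option.map_eq_some_iff.1 hs
    have hM : M c.q c.Tape.head = none := Option.map_eq_none_iff.1 hnone
    rw [RowSystem.run_succ]
    change Option.bind _ _ = none
    rw [hq, hρ]
    simp [hqc, tapeRow, Tape.right₀, hM]

end TuringMachine

/-! ### Row systems for recursively enumerable languages -/

section Encoding

open Turing PartrecToTM2

instance : Finite K' :=
  Finite.of_surjective ![K'.main, K'.rev, K'.aux, K'.stack] fun
    | .main => ⟨0, rfl⟩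
    | .rev => ⟨1, rfl⟩
    | .aux => ⟨2, rfl⟩
    | .stack => ⟨3, rfl⟩

/-- For a recursively enumerable set of numbers there is a finite row system that halts on the
binary expansion of a number iff the number lies in the set. -/
theorem exists_rowSystem {p : ℕ → Prop} (hp : REPred p) :
    ∃ (S C : Type) (_ : Finite S) (_ : Finite C) (R : RowSystem S C) (blank bottom : C)
      (sym : Γ' → C), ∀ n, R.Halts (fun k => (bottom :: (trNat n).reverse.map sym).getD k blank) ↔
        p n := by
  -- A partial function with values `0` and domain `p`, as a program on lists of numbers.
  have hf : Partrec fun n => (Part.assert (p n) fun _ => Part.some ()).map fun _ => 0 :=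
    hp.map (Computable.const 0).to₂
  obtain ⟨c, hc⟩ := ToPartrec.Code.exists_code (Nat.Partrec'.part_iff₁.2 hf)
  -- The start of the stack machine is its default label, which therefore has to be set here.
  let _ : Inhabited Λ' := ⟨trNormal c Cont'.halt⟩
  have hsupp : TM2.Supports tr (codeSupp c Cont'.halt) := tr_supports c Cont'.halt
  have hsupp₀ := TM1to0.tr_supports _ (TM2to1.tr_supports tr hsupp)
  have : Finite (TM2to1.Γ' K' fun _ => Γ') := inferInstanceAs (Finite (Bool × (K' → Option Γ')))
  let sym (b : Bool) (a : Γ') : TM2to1.Γ' K' fun _ => Γ' :=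
    (b, Function.update (fun _ => none) K'.main (some a))
  refine ⟨_, (TM2to1.Γ' K' fun _ => Γ') × (TM2to1.Γ' K' fun _ => Γ'), inferInstance, inferInstance,
    tmSystem (TM1to0.tr (TM2to1.tr tr)) _ ⟨default, hsupp₀.1⟩, default, (default, sym true Γ'.cons),
    fun a => (default, sym false a), fun n => ?_⟩
  have hrow := tmSystem_halts_iff hsupp₀ (TM2to1.trInit K'.main (trList [n]))
  rw [TM1to0.tr_eval] at hrow
  replace hrow := hrow.trans (TM2to1.tr_eval_dom tr K'.main (trList [n]))
  refine Iff.trans (iff_of_eq (congrArg _ (funext fun k => ?_))) (hrow.trans ?_)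
  -- The first cell of the initial tape, marked as the bottom of the stacks, holds the separator
  -- that ends the only number of the input list.
  · have hinit : TM2to1.trInit (Γ := fun _ => Γ') K'.main (trList [n]) =
        sym true Γ'.cons :: (trNat n).reverse.map (sym false) := by
      simp only [TM2to1.trInit, trList, List.reverse_append, List.reverse_cons, List.reverse_nil,
        List.nil_append, List.singleton_append]
      rfl
    have hmap : ((default, sym true Γ'.cons) :: (trNat n).reverse.map fun a => (default, sym false a) :
        List ((TM2to1.Γ' K' fun _ => Γ') × (TM2to1.Γ' K' fun _ => Γ'))) =
        (sym true Γ'.cons :: (trNat n).reverse.map (sym false)).map fun x => (default, x) := by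
      simp
    rw [hinit, hmap]
    generalize sym true Γ'.cons :: (trNat n).reverse.map (sym false) = l
    have hl : tapeRow (Tape.mk₁ l) k = (default, l.getI k) := by
      simp only [tapeRow, Tape.mk₁, Tape.mk₂, Tape.mk'_left, Tape.mk'_right₀, ListBlank.nth_mk]
      rfl
    rw [hl, List.getD_eq_getElem?_getD, List.getI_eq_getElem?_getD, List.getElem?_map]
    cases l[k]? <;> rfl
  · have hstart : (TM2.init K'.main (trList [n]) : TM2.Cfg (fun _ : K' => Γ') Λ' (Option Γ')) =
        init c [n] := by
      unfold TM2.init init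
      congr 1
      funext k
      cases k <;> rfl
    have heval := tr_eval c [n]
    rw [← hstart, hc ⟨[n], rfl⟩] at heval
    change (StateTransition.eval _ _).Dom ↔ _
    rw [heval]
    simp only [Part.map_eq_map]
    change (∃ _ : p n, _) ↔ p n
    simp [Part.some]

/-- The coding of words as positive numbers: read in binary, with the most significant digit first,
the code of `w` is a digit `1`, followed for each letter `a` of `w` by `encode a` digits `1` and a
digit `0`. -/
def posCode {A : Type*} [Encodable A] (w : List A) : PosNum :=
  w.foldl (fun n a => (PosNum.bit1^[Encodable.encode a] n).bit0) PosNum.one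

/-- The digits that the coding of words appends for a letter. -/
def letterDigits {A : Type*} [Encodable A] (a : A) : List Γ' :=
  List.replicate (Encodable.encode a) Γ'.bit1 ++ [Γ'.bit0]

/-- Mathlib's Turing machines hold a number with its least significant digit on top of the stack;
hence its digits appear on the tape from left to right as the word spells them. -/
theorem reverse_trNat_posCode {A : Type*} [Encodable A] (w : List A) :
    (trNat (posCode w : ℕ)).reverse = Γ'.bit1 :: w.flatMap letterDigits := by
  have hbits : ∀ (k : ℕ) (n : PosNum), (trPosNum (PosNum.bit1^[k] n)).reverse =
      (trPosNum n).reverse ++ List.replicate k Γ'.bit1 := by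
    intro k n
    induction k with
    | zero => simp
    | succ k ih =>
      rw [Function.iterate_succ_apply', trPosNum, List.reverse_cons, ih, List.append_assoc,
        List.replicate_succ']
  have key : ∀ (w : List A) (n : PosNum),
      (trPosNum (w.foldl (fun n a => (PosNum.bit1^[Encodable.encode a] n).bit0) n)).reverse =
        (trPosNum n).reverse ++ w.flatMap letterDigits := by
    intro w
    induction w with
    | nil => simp
    | cons a w ih =>
      intro n
      rw [List.foldl_cons, ih, trPosNum, List.reverse_cons, hbits, List.flatMap_cons, letterDigits]
      simp
  have hcast : ((posCode w : ℕ) : Num) = Num.pos (posCode w) := by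
    have := Num.of_to_nat (Num.pos (posCode w))
    rwa [Num.cast_pos] at this
  rw [trNat, hcast, trNum, posCode, key]
  rfl

theorem flatMap_letterDigits_injective {A : Type*} [Encodable A] :
    Function.Injective fun w : List A => w.flatMap letterDigits := by
  have hpre : ∀ (k m : ℕ) (r s : List Γ'), List.replicate k Γ'.bit1 ++ Γ'.bit0 :: r =
      List.replicate m Γ'.bit1 ++ Γ'.bit0 :: s → k = m ∧ r = s := by
    intro k
    induction k with
    | zero => rintro (_ | m) r s h <;> simp_all [List.replicate_succ]
    | succ k ih =>
      rintro (_ | m) r s h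
      · simp [List.replicate_succ] at h
      · simp only [List.replicate_succ, List.cons_append, List.cons.injEq, true_and] at h
        obtain ⟨rfl, rfl⟩ := ih m r s h
        exact ⟨rfl, rfl⟩
  intro w
  induction w with
  | nil => rintro (_ | ⟨b, v⟩) h <;> simp_all [letterDigits]
  | cons a w ih =>
    rintro (_ | ⟨b, v⟩) h
    · simp [letterDigits] at h
    · simp only [List.flatMap_cons, letterDigits, List.append_assoc, List.singleton_append] at h
      obtain ⟨h1, h2⟩ := hpre _ _ _ _ h
      rw [Encodable.encode_injective h1, ih h2]

theorem posCode_injective {A : Type*} [Encodable A] :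
    Function.Injective fun w : List A => (posCode w : ℕ) := by
  intro v w h
  have := congrArg (fun n => (trNat n).reverse) h
  simp only [reverse_trNat_posCode, List.cons.injEq, true_and] at this
  exact flatMap_letterDigits_injective this

theorem primrec_posCode {A : Type*} [Primcodable A] :
    Primrec fun w : List A => (posCode w : ℕ) := by
  have hstep : Primrec fun y : List A × ℕ × A =>
      2 * (fun n => 2 * n + 1)^[Encodable.encode y.2.2] y.2.1 := by
    refine Primrec.nat_mul.comp (Primrec.const 2) (Primrec.nat_iterate
      (Primrec.encode.comp (Primrec.snd.comp Primrec.snd)) (Primrec.fst.comp Primrec.snd) ?_)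
    exact (Primrec.succ.comp (Primrec.nat_mul.comp (Primrec.const 2) Primrec.snd)).to₂
  refine (Primrec.list_foldl Primrec.id (Primrec.const 1) hstep.to₂).of_eq fun w => ?_
  have hbits : ∀ (k : ℕ) (n : PosNum),
      ((PosNum.bit1^[k] n : PosNum) : ℕ) = (fun n => 2 * n + 1)^[k] (n : ℕ) := by
    intro k n
    induction k with
    | zero => rfl
    | succ k ih =>
      rw [Function.iterate_succ_apply', Function.iterate_succ_apply', PosNum.cast_bit1, ih]
      ring
  have key : ∀ (w : List A) (n : PosNum),
      w.foldl (fun n a => 2 * (fun n => 2 * n + 1)^[Encodable.encode a] n) (n : ℕ) =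
        ((w.foldl (fun n a => (PosNum.bit1^[Encodable.encode a] n).bit0) n : PosNum) : ℕ) := by
    intro w
    induction w with
    | nil => exact fun _ => rfl
    | cons a w ih =>
      intro n
      rw [List.foldl_cons, List.foldl_cons, ← ih, PosNum.cast_bit0, hbits, two_mul]
  exact key w PosNum.one

/-- For a recursively enumerable language there is a finite row system that halts on the rows
spelling the words of the language, for a suitable choice of the blocks. -/
theorem exists_rowSystem_emittedRow {A : Type*} [Primcodable A] {L : Language A}
    (hL : L ∈ classRE A) :
    ∃ (S C : Type) (_ : Finite S) (_ : Finite C) (R : RowSystem S C) (blk : TapeSymbol A → List C)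
      (blank : C), ∀ w, R.Halts (emittedRow blk blank w) ↔ w ∈ L := by
  have hp : REPred fun n : ℕ => ∃ w : List A, (posCode w : ℕ) = n ∧ w ∈ L := by
    refine rePred_exists (q := fun x : ℕ × List A => (posCode x.2 : ℕ) = x.1 ∧ x.2 ∈ L)
      (rePred_and ?_ (rePred_comp hL Computable.snd))
    exact (Primrec.eq.comp (primrec_posCode.comp Primrec.snd) Primrec.fst).computablePred.to_re
  obtain ⟨S, C, hS, hC, R, blank, bottom, sym, hR⟩ := exists_rowSystem hp
  let blk : TapeSymbol A → List C
    | .leftEnd => [bottom, sym Γ'.bit1]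
    | .letter a => (letterDigits a).map sym
    | .rightEnd => [blank]
  refine ⟨S, C, hS, hC, R, blk, blank, fun w => ?_⟩
  have hrow : emittedRow blk blank w = fun k =>
      (bottom :: (trNat (posCode w : ℕ)).reverse.map sym).getD k blank := by
    funext k
    have hblk : ∀ σ, blk σ ≠ [] := by
      rintro (_ | a | _) <;> simp [blk, letterDigits]
    rw [emittedRow_eq blk blank hblk rfl, reverse_trNat_posCode]
    have hflat : (tapeFrom w 0).flatMap blk =
        (bottom :: (Γ'.bit1 :: w.flatMap letterDigits).map sym) ++ [blank] := by
      simp [tapeFrom, blk, List.flatMap_map, List.map_flatMap]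
    rw [hflat]
    generalize bottom :: (Γ'.bit1 :: w.flatMap letterDigits).map sym = l
    rcases Nat.lt_or_ge k l.length with h | h
    · rw [List.getD_append _ _ _ _ h]
    · rw [List.getD_append_right _ _ _ _ h, List.getD_eq_default _ _ h]
      cases k - l.length <;> simp
  rw [hrow, hR]
  constructor
  · rintro ⟨v, hv, hvL⟩
    rwa [← posCode_injective hv]
  · exact fun h => ⟨w, rfl, h⟩

end Encoding

theorem mem_recognizedClass_of_mem_classRE {G : Type*} [Group G]
    (hZ : ∃ H : Subgroup G, Nonempty (H ≃* Multiplicative (ℤ × ℤ)))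
    {S : Finset G} (hS : Submonoid.closure (S : Set G) = ⊤) {A : Type*} [Finite A] [Primcodable A]
    {L : Language A} (hL : L ∈ classRE A) : L ∈ recognizedClass (cayleyMemory G S) A := by
  obtain ⟨H, ⟨e⟩⟩ := hZ
  obtain ⟨T, C, _, _, R, blk, blank, hR⟩ := exists_rowSystem_emittedRow hL
  obtain ⟨K, hK⟩ := (Set.finite_range fun σ => (blk σ).length).bddAbove
  have hblk : ∀ σ, (blk σ).length ≤ K := fun σ => hK ⟨σ, rfl⟩
  refine Walker.mem_recognizedClass hS (φ := fun v => (e.symm (Multiplicative.ofAdd v) : G))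
    (fun u v => by simp) ?_ (checker R blk blank hblk)
    fun w => (checker_accepts_iff R blk blank hblk w).trans (hR w)
  exact Subtype.val_injective.comp (e.symm.injective.comp Multiplicative.ofAdd.injective)

end GuessAutomata

theorem mainTheorem9 {G : Type*} [Group G]
    (hword : GuessAutomata.DecidableWordProblem G)
    (hZ : ∃ H : Subgroup G, Nonempty (H ≃* Multiplicative (ℤ × ℤ)))
    (S : Finset G) (hS : Submonoid.closure (S : Set G) = ⊤)
    (A : Type*) [Finite A] [Primcodable A] :
    GuessAutomata.recognizedClass (GuessAutomata.cayleyMemory G S) A =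
      GuessAutomata.classRE A := by
  ext L
  exact ⟨GuessAutomata.mem_classRE_of_mem_recognizedClass hword,
    GuessAutomata.mem_recognizedClass_of_mem_classRE hZ hS⟩
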